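/- Let $h,w\ge 1$ be integers. For a real pixel image $x\in\mathbb R^{h\times w}$ (one colour channel) let $$\hat x(\omega)=\frac1{\sqrt{hw}}\sum_{m=0}^{h-1}\sum_{n=0}^{w-1}x(m,n)\,e^{-i(\omega_1m+\omega_2n)},\qquad \omega\in\mathbb R^2,$$ be its Fourier transform with unitary normalization (for $\omega=(2\pi k/h,2\pi l/w)$ it is the unitary two-dimensional discrete Fourier transform), and for $0\le u<h$, $0\le v<w$ let $$D_x(u,v)=\alpha_h(u)\alpha_w(v)\sum_{m=0}^{h-1}\sum_{n=0}^{w-1}x(m,n)\cos\frac{(2m+1)u\pi}{2h}\cos\frac{(2n+1)v\pi}{2w},\qquad \alpha_N(0)=\sqrt{1/N},\quad \alpha_N(u)=\sqrt{2/N}\ (u\ne0),$$ be its type-II discrete cosine transform (DCT). Let $T\ge0$, let $g\in L^2(0,T)$ be a deterministic real function, let $w_t$ be a standard Wiener process in $\mathbb R^{h\times w}$ (independent standard Brownian motions, one per pixel), let $x_0\in\mathbb R^{h\times w}$ be a fixed clean image, and let $x_t$, $0\le t\le T$, solve the forward diffusion $\mathrm dx_t=f(x_t,t)\,\mathrm dt+g(t)\,\mathrm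 dw_t$ started at $x_0$, with zero drift $f=0$ (the variance-exploding SDE). Then for every $t\in[0,T]$ and every frequency $\omega\in\mathbb R^2$ the following expectations are finite, and $$\mathbb E\big[|\hat x_t(\omega)|^2\big]=|\hat x_0(\omega)|^2+\int_0^t|g(s)|^2\,\mathrm ds ,$$ where the added term, which is the power $\mathbb E\big[|\hat\epsilon_t(\omega)|^2\big]$ of the noise $\epsilon_t=x_t-x_0$ at frequency $\omega$, does not depend on $\omega$. Consequently high frequencies are drowned first: suppose that the clean image satisfies a power law $|\hat x_0(\omega)|^2=K|\omega|^{-\alpha}$, with constants $K,\alpha>0$, for all $\omega$ in a set $S$ of nonzero frequencies, and let $\omega,\omega'\in S$ with $|\omega|<|\omega'|$. Then at every $t\in[0,T]$ with positive noise power the signal-to-noise ratio $|\hat x_0(\cdot)|^2/\mathbb E[|\hat\epsilon_t(\cdot)|^2]$ is strictly smaller at $\omega'$ than at $\omega$; and for every $\gamma>0$, if $|\hat x_0(\omega)|^2\le\gamma\,\mathbb E[|\hat\epsilon_t(\omega)|^2]$ for some $t\in[0,T]$, then there is $s<t$ such that $|\hat x_0(\omega')|^2\le\gamma\,\mathbb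 E[|\hat\epsilon_r(\omega')|^2]$ for all $r\in[s,T]$. All of this also holds with the DCT in place of the Fourier transform, that is, with $D_x(u,v)$ in place of $\hat x(\omega)$, and with $(\pi u/h,\pi v/w)$ as the frequency of the index $(u,v)$ in the power law. -/

import Mathlib

open MeasureTheory ProbabilityTheory Filter Topology
open scoped NNReal ENNReal

namespace SpectralDiffusion

/-! ### Images and their frequency transforms -/

/-- A pixel image with `h` rows and `w` columns (one colour channel). -/
abbrev Image (h w : ℕ) := Matrix (Fin h) (Fin w) ℝ

/-- The plane of spatial frequencies, with the Euclidean norm. -/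
abbrev Freq := EuclideanSpace ℝ (Fin 2)

/-- The Fourier transform of a pixel image at an arbitrary angular frequency `ω`,
with the unitary normalization:
`(h w)^(-1/2) ∑_{m,n} x(m,n) exp(-i (ω₀ m + ω₁ n))`.
At `ω = (2πk/h, 2πl/w)` this is the coefficient `(k, l)` of the unitary two-dimensional
discrete Fourier transform. -/
noncomputable def imageFourier {h w : ℕ} (x : Image h w) (ω : Freq) : ℂ :=
  ((1 / √((h : ℝ) * (w : ℝ)) : ℝ) : ℂ) *
    ∑ m : Fin h, ∑ n : Fin w,
      ((x m n : ℝ) : ℂ) *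
        Complex.exp (-Complex.I * ((ω 0 * ((m : ℕ) : ℝ) + ω 1 * ((n : ℕ) : ℝ) : ℝ) : ℂ))

/-- The normalization factors of the type-II discrete cosine transform of length `N`. -/
noncomputable def dctFactor (N u : ℕ) : ℝ :=
  if u = 0 then √(1 / (N : ℝ)) else √(2 / (N : ℝ))

/-- The two-dimensional type-II discrete cosine transform, at the index `k = (u, v)`. -/
noncomputable def imageDCT {h w : ℕ} (x : Image h w) (k : Fin h × Fin w) : ℝ :=
  dctFactor h k.1 * dctFactor w k.2 *
    ∑ m : Fin h, ∑ n : Fin w,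
      x m n * Real.cos ((2 * ((m : ℕ) : ℝ) + 1) * ((k.1 : ℕ) : ℝ) * Real.pi / (2 * (h : ℝ))) *
        Real.cos ((2 * ((n : ℕ) : ℝ) + 1) * ((k.2 : ℕ) : ℝ) * Real.pi / (2 * (w : ℝ)))

/-- The angular frequency `(πu/h, πv/w)` of the cosine basis function with index `(u, v)`. -/
noncomputable def dctFreq {h w : ℕ} (k : Fin h × Fin w) : Freq :=
  !₂[Real.pi * ((k.1 : ℕ) : ℝ) / (h : ℝ), Real.pi * ((k.2 : ℕ) : ℝ) / (w : ℝ)]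

/-! ### The Wiener process and the stochastic integral of a deterministic integrand -/

section Stochastic

variable {Ω : Type*} [MeasurableSpace Ω]

/-- The standard Wiener process with values in the space of `h × w` images: one Brownian motion
for each pixel, and the Brownian motions of different pixels are independent. -/
structure IsStandardWiener {h w : ℕ} (W : Fin h × Fin w → ℝ≥0 → Ω → ℝ) (P : Measure Ω) :
    Prop where
  brownian : ∀ p, IsBrownianReal (W p) P
  indep : iIndepFun (fun p ξ t ↦ W p t ξ) P

/-- A deterministic step function on `(0, ∞)`: it takes the value `val i` on
`(knot i, knot (i + 1)]` for `i < n`, and vanishes elsewhere. -/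
structure StepFunction where
  n : ℕ
  knot : ℕ → ℝ≥0
  mono : Monotone knot
  val : ℕ → ℝ

/-- The function on the real line described by a step function. -/
noncomputable def StepFunction.eval (φ : StepFunction) (s : ℝ) : ℝ :=
  ∑ i ∈ Finset.range φ.n,
    (Set.Ioc (φ.knot i : ℝ) (φ.knot (i + 1) : ℝ)).indicator (fun _ ↦ φ.val i) s

/-- The elementary stochastic integral of a step function over `[0, t]` against `B`. -/
noncomputable def StepFunction.stochIntegral (φ : StepFunction) (B : ℝ≥0 → Ω → ℝ) (t : ℝ≥0)
    (ξ : Ω) : ℝ :=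
  ∑ i ∈ Finset.range φ.n, φ.val i * (B (min (φ.knot (i + 1)) t) ξ - B (min (φ.knot i) t) ξ)

/-- `Y` is (a version of) the stochastic integral `∫₀ᵗ g(s) dB_s` of the deterministic function
`g`: it is the limit in `L²(P)` of the elementary integrals of step functions that converge to `g`
in `L²(0, t)`. -/
def IsWienerIntegral (B : ℝ≥0 → Ω → ℝ) (P : Measure Ω) (g : ℝ → ℝ) (t : ℝ≥0) (Y : Ω → ℝ) :
    Prop :=
  MemLp Y 2 P ∧ ∃ φ : ℕ → StepFunction,
    Tendsto (fun n ↦ eLpNorm (fun s ↦ (φ n).eval s - g s) 2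
      (volume.restrict (Set.Ioc (0 : ℝ) (t : ℝ)))) atTop (𝓝 0) ∧
    Tendsto (fun n ↦ eLpNorm (fun ξ ↦ (φ n).stochIntegral B t ξ - Y ξ) 2 P) atTop (𝓝 0)

/-- The image-valued process `x` solves `dx_t = f(x_t, t) dt + g(t) dW_t` on `[0, T]` with initial
image `x₀`, in integral form: for every pixel and every `t ∈ [0, T]`,
`x_t - x₀ - ∫₀ᵗ f(x_s, s) ds` is the stochastic integral `∫₀ᵗ g(s) dW_s`.
(For zero drift such a process is automatically adapted to the completed filtration of `W`.) -/
structure IsForwardDiffusion {h w : ℕ} (f : Image h w → ℝ → Image h w) (g : ℝ → ℝ) (T : ℝ≥0)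
    (W : Fin h × Fin w → ℝ≥0 → Ω → ℝ) (P : Measure Ω) (x₀ : Image h w)
    (x : ℝ≥0 → Ω → Image h w) : Prop where
  drift_integrable : ∀ᵐ ξ ∂P, ∀ m n,
    IntervalIntegrable (fun s : ℝ ↦ f (x s.toNNReal ξ) s m n) volume 0 T
  integral_eq : ∀ t ≤ T, ∀ m n, IsWienerIntegral (W (m, n)) P g t
    (fun ξ ↦ x t ξ m n - x₀ m n - ∫ s in (0 : ℝ)..(t : ℝ), f (x s.toNNReal ξ) s m n)

/-! ### Signal power, noise power, and the order in which frequencies are destroyed -/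

variable {h w : ℕ} {ι V : Type*} [Norm V]

/-- The power of the added noise `x_t - x₀` at the frequency index `k`, for the transform `F`. -/
noncomputable def noisePower (F : Image h w → ι → V) (P : Measure Ω) (x₀ : Image h w)
    (x : ℝ≥0 → Ω → Image h w) (t : ℝ≥0) (k : ι) : ℝ :=
  ∫ ξ, ‖F (x t ξ - x₀) k‖ ^ 2 ∂P

/-- The signal-to-noise ratio at time `t` and frequency index `k`
(meaningful when the noise power is positive). -/
noncomputable def snr (F : Image h w → ι → V) (P : Measure Ω) (x₀ : Image h w)
    (x : ℝ≥0 → Ω → Image h w) (t : ℝ≥0) (k : ι) : ℝ :=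
  ‖F x₀ k‖ ^ 2 / noisePower F P x₀ x t k

/-- The frequency index `k` is drowned at level `γ` at time `t`: the power of the clean image is at
most `γ` times the power of the noise (the signal-to-noise ratio is at most `γ`). -/
def Drowned (F : Image h w → ι → V) (P : Measure Ω) (x₀ : Image h w)
    (x : ℝ≥0 → Ω → Image h w) (γ : ℝ) (t : ℝ≥0) (k : ι) : Prop :=
  ‖F x₀ k‖ ^ 2 ≤ γ * noisePower F P x₀ x t k

/-- High frequencies are drowned first: if the power spectrum of the clean image follows a power
law `K |ω|^(-α)` on a set `S` of nonzero frequencies, then for any two frequencies of `S` the higher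
one has the smaller signal-to-noise ratio at every time at which there is noise, and, for every
level `γ > 0`, if the lower one is drowned at time `t`, then the higher one is drowned from some
strictly earlier time on. -/
def HighFrequenciesDrownFirst (F : Image h w → ι → V) (freq : ι → Freq) (T : ℝ≥0)
    (P : Measure Ω) (x₀ : Image h w) (x : ℝ≥0 → Ω → Image h w) : Prop :=
  ∀ (K α : ℝ) (S : Set ι), 0 < K → 0 < α →
    (∀ k ∈ S, freq k ≠ 0 ∧ ‖F x₀ k‖ ^ 2 = K * ‖freq k‖ ^ (-α)) →
    ∀ j ∈ S, ∀ k ∈ S, ‖freq j‖ < ‖freq k‖ →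
      (∀ t ≤ T, 0 < noisePower F P x₀ x t k → snr F P x₀ x t k < snr F P x₀ x t j) ∧
      (∀ γ : ℝ, 0 < γ → ∀ t ≤ T, Drowned F P x₀ x γ t j →
        ∃ s < t, ∀ r, s ≤ r → r ≤ T → Drowned F P x₀ x γ r k)

end Stochastic

end SpectralDiffusion

open SpectralDiffusion

namespace SpectralDiffusion

/-! ### Second moments of linear combinations and limits in mean square -/

section SecondMoments

variable {Ω : Type*} [MeasurableSpace Ω] {μ : Measure Ω}

/-! With zero drift the noise in each pixel is a Wiener integral of `g`. Such integrals are centred,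
have second moment `∫ |g|²` by the Itô isometry, and are uncorrelated across pixels. The noise
covariance is thus a multiple of the identity, and a linear functional with coefficients `a` has
second moment `(∑ a²) ∫ |g|²`. Each power studied is a sum of squares of such functionals with total
square norm one, and the cross term with the clean image has mean zero; `transform_power` combines
these facts.

Drowning order: the noise power is the same at all frequencies, while the power law strictly
decreases. In time it is continuous and nondecreasing from zero, so the intermediate value theorem
yields a strictly earlier drowning time at the higher frequency. -/

theorem integral_sum_mul_sum {ι κ : Type*} (s : Finset ι) (r : Finset κ) (a : ι → ℝ) (b : κ → ℝ)
    (X : ι → Ω → ℝ) (Y : κ → Ω → ℝ) (hX : ∀ i, MemLp (X i) 2 μ) (hY : ∀ j, MemLp (Y j) 2 μ) :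
    ∫ ξ, (∑ i ∈ s, a i * X i ξ) * (∑ j ∈ r, b j * Y j ξ) ∂μ =
      ∑ i ∈ s, ∑ j ∈ r, a i * b j * ∫ ξ, X i ξ * Y j ξ ∂μ := by
  have hint : ∀ i j, Integrable (fun ξ ↦ a i * b j * (X i ξ * Y j ξ)) μ := fun i j ↦
    ((hX i).integrable_mul (hY j)).const_mul _
  have hexp : ∀ ξ, (∑ i ∈ s, a i * X i ξ) * (∑ j ∈ r, b j * Y j ξ) =
      ∑ i ∈ s, ∑ j ∈ r, a i * b j * (X i ξ * Y j ξ) := fun ξ ↦ by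
    rw [Finset.sum_mul_sum]
    exact Finset.sum_congr rfl fun i _ ↦ Finset.sum_congr rfl fun j _ ↦ by ring
  simp_rw [hexp]
  rw [integral_finsetSum _ fun i _ ↦ integrable_finsetSum _ fun j _ ↦ hint i j]
  refine Finset.sum_congr rfl fun i _ ↦ ?_
  rw [integral_finsetSum _ fun j _ ↦ hint i j]
  exact Finset.sum_congr rfl fun j _ ↦ integral_const_mul _ _

/-- The integral of a product is the inner product of `Lp` classes, which is jointly continuous. It
serves on `Ω` and on `(0, t]` alike. -/
theorem tendsto_integral_mul_of_tendsto_eLpNorm {X Y : ℕ → Ω → ℝ} {X' Y' : Ω → ℝ}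
    (hX : ∀ n, MemLp (X n) 2 μ) (hY : ∀ n, MemLp (Y n) 2 μ) (hX' : MemLp X' 2 μ)
    (hY' : MemLp Y' 2 μ)
    (h₁ : Tendsto (fun n ↦ eLpNorm (fun ξ ↦ X n ξ - X' ξ) 2 μ) atTop (𝓝 0))
    (h₂ : Tendsto (fun n ↦ eLpNorm (fun ξ ↦ Y n ξ - Y' ξ) 2 μ) atTop (𝓝 0)) :
    Tendsto (fun n ↦ ∫ ξ, X n ξ * Y n ξ ∂μ) atTop (𝓝 (∫ ξ, X' ξ * Y' ξ ∂μ)) := by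
  have key : ∀ {U V : Ω → ℝ} (hU : MemLp U 2 μ) (hV : MemLp V 2 μ),
      inner ℝ (hU.toLp U) (hV.toLp V) = ∫ ξ, U ξ * V ξ ∂μ := by
    intro U V hU hV
    rw [L2.inner_def]
    refine integral_congr_ae ?_
    filter_upwards [hU.coeFn_toLp, hV.coeFn_toLp] with ξ h1 h2
    simp [h1, h2, mul_comm]
  have t₁ := (Lp.tendsto_Lp_iff_tendsto_eLpNorm'' X hX X' hX').2 h₁
  have t₂ := (Lp.tendsto_Lp_iff_tendsto_eLpNorm'' Y hY Y' hY').2 h₂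
  simpa only [key] using t₁.inner t₂ (𝕜 := ℝ)

end SecondMoments

/-! ### The isometry for step functions -/

section Isometry

variable {Ω : Type*} [MeasurableSpace Ω] {P : Measure Ω} {B B' : ℝ≥0 → Ω → ℝ}

theorem memLp_two_of_isPreBrownianReal (hB : IsPreBrownianReal B P) (s : ℝ≥0) :
    MemLp (B s) 2 P :=
  (hB.isGaussianProcess.hasGaussianLaw_eval s).memLp_two

theorem integral_mul_of_isPreBrownianReal (hB : IsPreBrownianReal B P) (s t : ℝ≥0) :
    ∫ ξ, B s ξ * B t ξ ∂P = min (s : ℝ) t := by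
  have : IsProbabilityMeasure P := hB.isGaussianProcess.isProbabilityMeasure
  have h := hB.covariance_eval s t
  rw [covariance_eq_sub (memLp_two_of_isPreBrownianReal hB s)
    (memLp_two_of_isPreBrownianReal hB t), hB.integral_eval, zero_mul, sub_zero] at h
  simpa using h

theorem integral_increment_mul_increment (hB : IsPreBrownianReal B P) (a b c d : ℝ≥0) :
    ∫ ξ, (B b ξ - B a ξ) * (B d ξ - B c ξ) ∂P =
      min (b : ℝ) d - min (b : ℝ) c - min (a : ℝ) d + min (a : ℝ) c := by
  have hint : ∀ s t, Integrable (fun ξ ↦ B s ξ * B t ξ) P := fun s t ↦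
    (memLp_two_of_isPreBrownianReal hB s).integrable_mul (memLp_two_of_isPreBrownianReal hB t)
  calc ∫ ξ, (B b ξ - B a ξ) * (B d ξ - B c ξ) ∂P
      = ∫ ξ, ((B b ξ * B d ξ - B b ξ * B c ξ) - (B a ξ * B d ξ - B a ξ * B c ξ)) ∂P :=
        integral_congr_ae (ae_of_all _ fun ξ ↦ by ring)
    _ = (∫ ξ, B b ξ * B d ξ ∂P - ∫ ξ, B b ξ * B c ξ ∂P) -
        (∫ ξ, B a ξ * B d ξ ∂P - ∫ ξ, B a ξ * B c ξ ∂P) := by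
        rw [← integral_sub (hint _ _) (hint _ _), ← integral_sub (hint _ _) (hint _ _)]
        exact integral_sub ((hint _ _).sub (hint _ _)) ((hint _ _).sub (hint _ _))
    _ = _ := by
        simp only [integral_mul_of_isPreBrownianReal hB]
        ring

/-- The length of the overlap within `(0, t]`, in the form taken by the covariance of two stopped
Brownian increments. -/
theorem integral_indicator_Ioc_mul_indicator_Ioc {a b c d t : ℝ} (ha : 0 ≤ a) (hab : a ≤ b)
    (hc : 0 ≤ c) (hcd : c ≤ d) (ht : 0 ≤ t) :
    ∫ s in Set.Ioc 0 t, (Set.Ioc a b).indicator (fun _ ↦ (1 : ℝ)) s *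
        (Set.Ioc c d).indicator (fun _ ↦ (1 : ℝ)) s =
      min (min b t) (min d t) - min (min b t) (min c t) - min (min a t) (min d t) +
        min (min a t) (min c t) := by
  have hprod : ∀ s : ℝ, (Set.Ioc a b).indicator (fun _ ↦ (1 : ℝ)) s *
      (Set.Ioc c d).indicator (fun _ ↦ (1 : ℝ)) s =
      (Set.Ioc (max a c) (min b d)).indicator (fun _ ↦ (1 : ℝ)) s := fun s ↦ by
    rw [← Set.Ioc_inter_Ioc, Set.inter_indicator_mul (fun _ ↦ (1 : ℝ)) (fun _ ↦ (1 : ℝ)) s |>.symm]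
    simp
  simp_rw [hprod]
  rw [setIntegral_indicator measurableSet_Ioc, setIntegral_const, Set.Ioc_inter_Ioc,
    Real.volume_real_Ioc]
  simp only [smul_eq_mul, mul_one]
  grind

namespace StepFunction

theorem memLp_indicator (φ : StepFunction) (t : ℝ) (i : ℕ) :
    MemLp ((Set.Ioc (φ.knot i : ℝ) (φ.knot (i + 1) : ℝ)).indicator (fun _ ↦ (1 : ℝ))) 2
      (volume.restrict (Set.Ioc 0 t)) :=
  (memLp_const 1).indicator measurableSet_Ioc

theorem eval_eq_sum (φ : StepFunction) (s : ℝ) :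
    φ.eval s = ∑ i ∈ Finset.range φ.n, φ.val i *
      (Set.Ioc (φ.knot i : ℝ) (φ.knot (i + 1) : ℝ)).indicator (fun _ ↦ (1 : ℝ)) s := by
  simp [eval, Set.indicator_apply]

theorem memLp_eval (φ : StepFunction) (t : ℝ) :
    MemLp φ.eval 2 (volume.restrict (Set.Ioc 0 t)) := by
  rw [funext φ.eval_eq_sum]
  exact memLp_finsetSum _ fun i _ ↦ (φ.memLp_indicator t i).const_mul _

theorem memLp_increment (φ : StepFunction) (hB : IsPreBrownianReal B P) (t : ℝ≥0) (i : ℕ) :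
    MemLp (fun ξ ↦ B (min (φ.knot (i + 1)) t) ξ - B (min (φ.knot i) t) ξ) 2 P :=
  (memLp_two_of_isPreBrownianReal hB _).sub (memLp_two_of_isPreBrownianReal hB _)

theorem memLp_stochIntegral (φ : StepFunction) (hB : IsPreBrownianReal B P) (t : ℝ≥0) :
    MemLp (φ.stochIntegral B t) 2 P :=
  memLp_finsetSum _ fun i _ ↦ (φ.memLp_increment hB t i).const_mul _

theorem integral_stochIntegral (φ : StepFunction) (hB : IsPreBrownianReal B P) (t : ℝ≥0) :
    ∫ ξ, φ.stochIntegral B t ξ ∂P = 0 := by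
  have hint : ∀ s, Integrable (B s) P := hB.integrable_eval
  simp only [stochIntegral]
  rw [integral_finsetSum _ fun i _ ↦ Integrable.const_mul (by exact (hint _).sub (hint _)) _]
  refine Finset.sum_eq_zero fun i _ ↦ ?_
  rw [integral_const_mul, integral_sub (hint _) (hint _), hB.integral_eval, hB.integral_eval]
  simp

/-- The isometry property of the elementary stochastic integral. -/
theorem integral_stochIntegral_mul_self (φ : StepFunction) (hB : IsPreBrownianReal B P)
    (t : ℝ≥0) :
    ∫ ξ, φ.stochIntegral B t ξ * φ.stochIntegral B t ξ ∂P =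
      ∫ s in Set.Ioc (0 : ℝ) t, φ.eval s * φ.eval s := by
  simp_rw [eval_eq_sum]
  rw [integral_sum_mul_sum _ _ _ _ _ _ (φ.memLp_indicator t) (φ.memLp_indicator t)]
  refine (integral_sum_mul_sum _ _ _ _ _ _ (φ.memLp_increment hB t)
    (φ.memLp_increment hB t)).trans ?_
  -- The two double sums agree term by term, off the diagonal too, so disjointness of the intervals
  -- is not needed.
  refine Finset.sum_congr rfl fun i _ ↦ Finset.sum_congr rfl fun j _ ↦ ?_
  rw [integral_increment_mul_increment hB, integral_indicator_Ioc_mul_indicator_Ioc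
    (φ.knot i).coe_nonneg (NNReal.coe_le_coe.2 (φ.mono (Nat.le_add_right i 1))) (φ.knot j).coe_nonneg
    (NNReal.coe_le_coe.2 (φ.mono (Nat.le_add_right j 1))) t.coe_nonneg]
  simp only [NNReal.coe_min]

theorem integral_stochIntegral_mul_of_indepFun (φ ψ : StepFunction)
    (hB : IsPreBrownianReal B P) (hB' : IsPreBrownianReal B' P)
    (hind : IndepFun (fun ξ t ↦ B t ξ) (fun ξ t ↦ B' t ξ) P) (t : ℝ≥0) :
    ∫ ξ, φ.stochIntegral B t ξ * ψ.stochIntegral B' t ξ ∂P = 0 := by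
  -- The elementary integral reads finitely many coordinates of the path, so independence of paths
  -- passes to it.
  have hmeas : ∀ χ : StepFunction, Measurable fun y : ℝ≥0 → ℝ ↦ ∑ i ∈ Finset.range χ.n,
      χ.val i * (y (min (χ.knot (i + 1)) t) - y (min (χ.knot i) t)) := fun χ ↦ by fun_prop
  have h : IndepFun (φ.stochIntegral B t) (ψ.stochIntegral B' t) P :=
    hind.comp (hmeas φ) (hmeas ψ)
  rw [h.integral_fun_mul_eq_mul_integral (φ.memLp_stochIntegral hB t).aestronglyMeasurable
    (ψ.memLp_stochIntegral hB' t).aestronglyMeasurable, φ.integral_stochIntegral hB t, zero_mul]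

end StepFunction

/-! ### Moments of Wiener integrals -/

variable {g : ℝ → ℝ} {t : ℝ≥0} {Y Y' : Ω → ℝ}

theorem IsWienerIntegral.integral_eq_zero (hY : IsWienerIntegral B P g t Y)
    (hB : IsPreBrownianReal B P) : ∫ ξ, Y ξ ∂P = 0 := by
  have : IsProbabilityMeasure P := hB.isGaussianProcess.isProbabilityMeasure
  obtain ⟨hL, φ, -, hφ⟩ := hY
  -- The mean is the pairing with the constant 1.
  have h := tendsto_integral_mul_of_tendsto_eLpNorm (Y := fun _ _ ↦ 1) (Y' := fun _ ↦ 1)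
    (fun n ↦ (φ n).memLp_stochIntegral hB t) (fun _ ↦ memLp_const 1) hL (memLp_const 1) hφ
    (by simp)
  simp only [mul_one, StepFunction.integral_stochIntegral _ hB] at h
  exact tendsto_nhds_unique h tendsto_const_nhds

/-- The step-function isometry equates two sequences, one converging by the limit in `L²(P)`, the
other by the limit in `L²(0, t)`. -/
theorem IsWienerIntegral.integral_mul_self (hY : IsWienerIntegral B P g t Y)
    (hB : IsPreBrownianReal B P) (hg : MemLp g 2 (volume.restrict (Set.Ioc (0 : ℝ) t))) :
    ∫ ξ, Y ξ * Y ξ ∂P = ∫ s in (0 : ℝ)..t, |g s| ^ 2 := by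
  obtain ⟨hL, φ, hφg, hφ⟩ := hY
  have h := tendsto_integral_mul_of_tendsto_eLpNorm (fun n ↦ (φ n).memLp_stochIntegral hB t)
    (fun n ↦ (φ n).memLp_stochIntegral hB t) hL hL hφ hφ
  have h' := tendsto_integral_mul_of_tendsto_eLpNorm (fun n ↦ (φ n).memLp_eval t)
    (fun n ↦ (φ n).memLp_eval t) hg hg hφg hφg
  simp only [StepFunction.integral_stochIntegral_mul_self _ hB] at h
  rw [tendsto_nhds_unique h h', intervalIntegral.integral_of_le t.coe_nonneg]
  simp only [sq_abs]
  simp only [sq]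

theorem IsWienerIntegral.integral_mul_of_indepFun (hY : IsWienerIntegral B P g t Y)
    (hY' : IsWienerIntegral B' P g t Y') (hB : IsPreBrownianReal B P)
    (hB' : IsPreBrownianReal B' P)
    (hind : IndepFun (fun ξ t ↦ B t ξ) (fun ξ t ↦ B' t ξ) P) :
    ∫ ξ, Y ξ * Y' ξ ∂P = 0 := by
  obtain ⟨hL, φ, -, hφ⟩ := hY
  obtain ⟨hL', ψ, -, hψ⟩ := hY'
  have h := tendsto_integral_mul_of_tendsto_eLpNorm (fun n ↦ (φ n).memLp_stochIntegral hB t)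
    (fun n ↦ (ψ n).memLp_stochIntegral hB' t) hL hL' hφ hψ
  simp only [StepFunction.integral_stochIntegral_mul_of_indepFun _ _ hB hB' hind] at h
  exact tendsto_nhds_unique h tendsto_const_nhds

end Isometry

/-! ### Linear functionals of the noise -/

section Linear

variable {Ω : Type*} [MeasurableSpace Ω] {P : Measure Ω} {h w : ℕ}

/-- The linear functional on images with the coefficients `a`. -/
def imagePairing (a : Fin h × Fin w → ℝ) (x : Image h w) : ℝ :=
  ∑ p, a p * x p.1 p.2

variable {g : ℝ → ℝ} {t : ℝ≥0} {W : Fin h × Fin w → ℝ≥0 → Ω → ℝ} {N : Ω → Image h w}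

theorem memLp_imagePairing (hN : ∀ p : Fin h × Fin w, MemLp (fun ξ ↦ N ξ p.1 p.2) 2 P)
    (a : Fin h × Fin w → ℝ) : MemLp (fun ξ ↦ imagePairing a (N ξ)) 2 P :=
  memLp_finsetSum _ fun p _ ↦ (hN p).const_mul _

theorem integral_imagePairing [IsProbabilityMeasure P] (hW : IsStandardWiener W P)
    (hN : ∀ p : Fin h × Fin w, IsWienerIntegral (W p) P g t (fun ξ ↦ N ξ p.1 p.2))
    (a : Fin h × Fin w → ℝ) : ∫ ξ, imagePairing a (N ξ) ∂P = 0 := by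
  simp only [imagePairing]
  rw [integral_finsetSum _ fun p _ ↦ ((hN p).1.integrable one_le_two).const_mul _]
  refine Finset.sum_eq_zero fun p _ ↦ ?_
  rw [integral_const_mul, (hN p).integral_eq_zero (hW.brownian p).toIsPreBrownianReal, mul_zero]

theorem integral_imagePairing_sq (hW : IsStandardWiener W P)
    (hg : MemLp g 2 (volume.restrict (Set.Ioc (0 : ℝ) t)))
    (hN : ∀ p : Fin h × Fin w, IsWienerIntegral (W p) P g t (fun ξ ↦ N ξ p.1 p.2))
    (a : Fin h × Fin w → ℝ) :
    ∫ ξ, imagePairing a (N ξ) ^ 2 ∂P = (∑ p, a p ^ 2) * ∫ s in (0 : ℝ)..t, |g s| ^ 2 := by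
  simp only [imagePairing, sq (∑ p, _)]
  rw [integral_sum_mul_sum _ _ _ _ _ _ (fun p ↦ (hN p).1) (fun p ↦ (hN p).1), Finset.sum_mul]
  refine Finset.sum_congr rfl fun p _ ↦ ?_
  rw [Finset.sum_eq_single p, (hN p).integral_mul_self (hW.brownian p).toIsPreBrownianReal hg, sq]
  · intro q _ hq
    rw [(hN p).integral_mul_of_indepFun (hN q) (hW.brownian p).toIsPreBrownianReal
      (hW.brownian q).toIsPreBrownianReal (hW.indep.indepFun hq.symm), mul_zero]
  · simp

theorem integral_imagePairing_add_sq [IsProbabilityMeasure P] (hW : IsStandardWiener W P)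
    (hg : MemLp g 2 (volume.restrict (Set.Ioc (0 : ℝ) t)))
    (hN : ∀ p : Fin h × Fin w, IsWienerIntegral (W p) P g t (fun ξ ↦ N ξ p.1 p.2))
    (a : Fin h × Fin w → ℝ) (c : ℝ) :
    ∫ ξ, (c + imagePairing a (N ξ)) ^ 2 ∂P =
      c ^ 2 + (∑ p, a p ^ 2) * ∫ s in (0 : ℝ)..t, |g s| ^ 2 := by
  have hL := memLp_imagePairing (fun p ↦ (hN p).1) a
  calc ∫ ξ, (c + imagePairing a (N ξ)) ^ 2 ∂P
      = ∫ ξ, ((c ^ 2 + 2 * c * imagePairing a (N ξ)) + imagePairing a (N ξ) ^ 2) ∂P :=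
        integral_congr_ae (ae_of_all _ fun ξ ↦ by ring)
    _ = _ := by
        have hi := (hL.integrable one_le_two).const_mul (2 * c)
        rw [integral_add (by exact (integrable_const _).add hi) hL.integrable_sq,
          integral_add (integrable_const _) hi, integral_const_mul,
          integral_imagePairing hW hN, integral_imagePairing_sq hW hg hN]
        simp

/-- Noise moments for a transform whose power is a finite sum of squares of linear functionals
with coefficient vectors of total square norm one. -/
theorem transform_power [IsProbabilityMeasure P] {V ι κ : Type*} [Norm V] [Fintype κ]
    {T : ℝ≥0} (hg : MemLp g 2 (volume.restrict (Set.Ioc (0 : ℝ) T)))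
    (hW : IsStandardWiener W P) {x₀ : Image h w} {x : ℝ≥0 → Ω → Image h w}
    (hx : IsForwardDiffusion (fun _ _ ↦ 0) g T W P x₀ x)
    (F : Image h w → ι → V) (k : ι) (a : κ → Fin h × Fin w → ℝ)
    (hF : ∀ y, ‖F y k‖ ^ 2 = ∑ i, imagePairing (a i) y ^ 2) (ha : ∑ i, ∑ p, a i p ^ 2 = 1)
    (ht : t ≤ T) :
    Integrable (fun ξ ↦ ‖F (x t ξ) k‖ ^ 2) P ∧
      ∫ ξ, ‖F (x t ξ) k‖ ^ 2 ∂P = ‖F x₀ k‖ ^ 2 + ∫ s in (0 : ℝ)..(t : ℝ), |g s| ^ 2 ∧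
      Integrable (fun ξ ↦ ‖F (x t ξ - x₀) k‖ ^ 2) P ∧
      noisePower F P x₀ x t k = ∫ s in (0 : ℝ)..(t : ℝ), |g s| ^ 2 := by
  have hgt : MemLp g 2 (volume.restrict (Set.Ioc (0 : ℝ) t)) :=
    hg.mono_measure (Measure.restrict_mono (Set.Ioc_subset_Ioc_right (mod_cast ht)) le_rfl)
  -- The drift integral vanishes, so the noise itself is the Wiener integral.
  have hN : ∀ p : Fin h × Fin w,
      IsWienerIntegral (W p) P g t (fun ξ ↦ (x t ξ - x₀) p.1 p.2) := fun p ↦ by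
    simpa using hx.integral_eq t ht p.1 p.2
  have hL : ∀ i, MemLp (fun ξ ↦ imagePairing (a i) (x t ξ - x₀)) 2 P := fun i ↦
    memLp_imagePairing (fun p ↦ (hN p).1) (a i)
  have hadd : ∀ i ξ, imagePairing (a i) (x t ξ) =
      imagePairing (a i) x₀ + imagePairing (a i) (x t ξ - x₀) := fun i ξ ↦ by
    simp only [imagePairing, ← Finset.sum_add_distrib, Matrix.sub_apply]
    exact Finset.sum_congr rfl fun p _ ↦ by ring
  have hI : ∀ i, Integrable (fun ξ ↦ (imagePairing (a i) x₀ +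
      imagePairing (a i) (x t ξ - x₀)) ^ 2) P := fun i ↦ by
    have hc : MemLp (fun _ : Ω ↦ imagePairing (a i) x₀) 2 P := memLp_const _
    exact (hc.add (hL i)).integrable_sq
  simp only [noisePower, hF, hadd]
  refine ⟨integrable_finsetSum _ fun i _ ↦ hI i, ?_,
    integrable_finsetSum _ fun i _ ↦ (hL i).integrable_sq, ?_⟩
  · rw [integral_finsetSum _ fun i _ ↦ hI i]
    simp only [integral_imagePairing_add_sq (N := fun ξ ↦ x t ξ - x₀) hW hgt hN,
      Finset.sum_add_distrib, ← Finset.sum_mul, ha, one_mul]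
  · rw [integral_finsetSum _ fun i _ ↦ (hL i).integrable_sq]
    simp only [integral_imagePairing_sq (N := fun ξ ↦ x t ξ - x₀) hW hgt hN,
      ← Finset.sum_mul, ha, one_mul]

end Linear

/-! ### The coefficients of the transforms -/

section Coefficients

variable {h w : ℕ}

/-- Squared real and imaginary parts; the sign of the sine part disappears in the square. -/
theorem norm_imageFourier_sq (x : Image h w) (ω : Freq) :
    ‖imageFourier x ω‖ ^ 2 = ∑ i : Fin 2, imagePairing
      (fun p ↦ 1 / √((h : ℝ) * w) *
        ![Real.cos, Real.sin] i (ω 0 * ((p.1 : ℕ) : ℝ) + ω 1 * ((p.2 : ℕ) : ℝ))) x ^ 2 := by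
  have hexp : ∀ θ : ℝ, Complex.exp (-Complex.I * (θ : ℂ)) =
      ((Real.cos θ : ℝ) : ℂ) - ((Real.sin θ : ℝ) : ℂ) * Complex.I := fun θ ↦ by
    rw [show -Complex.I * (θ : ℂ) = (-(θ : ℂ)) * Complex.I by ring, Complex.exp_mul_I]
    simp [sub_eq_add_neg]
  have hz : imageFourier x ω =
      ((imagePairing (fun p ↦ 1 / √((h : ℝ) * w) *
        Real.cos (ω 0 * ((p.1 : ℕ) : ℝ) + ω 1 * ((p.2 : ℕ) : ℝ))) x : ℝ) : ℂ) +
      ((-imagePairing (fun p ↦ 1 / √((h : ℝ) * w) *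
        Real.sin (ω 0 * ((p.1 : ℕ) : ℝ) + ω 1 * ((p.2 : ℕ) : ℝ))) x : ℝ) : ℂ) * Complex.I := by
    simp only [imageFourier, imagePairing, ← Fintype.sum_prod_type', Complex.ofReal_neg,
      Complex.ofReal_sum, Finset.mul_sum, neg_mul, Finset.sum_mul, ← sub_eq_add_neg,
      ← Finset.sum_sub_distrib]
    refine Finset.sum_congr rfl fun p _ ↦ ?_
    rw [← neg_mul, hexp]
    simp only [Complex.ofReal_mul]
    ring
  rw [hz, Complex.sq_norm, Complex.normSq_add_mul_I, Fin.sum_univ_two, neg_sq]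
  rfl

/-- Each pixel contributes `(cos² + sin²) / (h w)`, whence every real frequency is allowed, not only
the DFT grid. -/
theorem sum_fourier_coeff_sq (hh : 0 < h) (hw : 0 < w) (ω : Freq) :
    ∑ i : Fin 2, ∑ p : Fin h × Fin w, (1 / √((h : ℝ) * w) *
      ![Real.cos, Real.sin] i (ω 0 * ((p.1 : ℕ) : ℝ) + ω 1 * ((p.2 : ℕ) : ℝ))) ^ 2 = 1 := by
  have hpos : (0 : ℝ) < (h : ℝ) * w := by positivity
  rw [Fin.sum_univ_two, ← Finset.sum_add_distrib]
  simp only [Matrix.cons_val_zero, Matrix.cons_val_one, mul_pow, ← mul_add, Real.cos_sq_add_sin_sq,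
    div_pow, Real.sq_sqrt hpos.le]
  simp
  field_simp

/-- The sum telescopes: `2 sin θ cos((2m+1)θ) = sin((2m+2)θ) - sin(2mθ)`. -/
theorem sum_cos_odd_mul (n : ℕ) (θ : ℝ) :
    2 * Real.sin θ * ∑ m : Fin n, Real.cos ((2 * ((m : ℕ) : ℝ) + 1) * θ) =
      Real.sin (2 * n * θ) := by
  rw [Fin.sum_univ_eq_sum_range fun m : ℕ ↦ Real.cos ((2 * (m : ℝ) + 1) * θ)]
  induction n with
  | zero => simp
  | succ n ih =>
    rw [Finset.sum_range_succ, mul_add, ih, Real.two_mul_sin_mul_cos]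
    have h1 : θ - (2 * (n : ℝ) + 1) * θ = -(2 * n * θ) := by ring
    have h2 : θ + (2 * (n : ℝ) + 1) * θ = 2 * ((n + 1 : ℕ) : ℝ) * θ := by push_cast; ring
    rw [h1, h2, Real.sin_neg]
    ring

/-- The basis vectors of the one-dimensional type-II cosine transform have norm one. -/
theorem sum_dct_coeff_sq {n : ℕ} (u : Fin n) :
    ∑ m : Fin n, (dctFactor n u *
      Real.cos ((2 * ((m : ℕ) : ℝ) + 1) * ((u : ℕ) : ℝ) * Real.pi / (2 * (n : ℝ)))) ^ 2 = 1 := by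
  have hn : (0 : ℝ) < n := by exact_mod_cast u.pos
  by_cases hu : (u : ℕ) = 0
  · simp [dctFactor, hu, hn.ne']
  · set θ : ℝ := (u : ℕ) * Real.pi / n with hθ
    have hu' : (0 : ℝ) < (u : ℕ) := by exact_mod_cast Nat.pos_of_ne_zero hu
    have hun : ((u : ℕ) : ℝ) < n := by exact_mod_cast u.2
    have hsin : 0 < Real.sin θ := Real.sin_pos_of_pos_of_lt_pi (by positivity) (by
      rw [hθ, div_lt_iff₀ hn, mul_comm]
      exact mul_lt_mul_of_pos_left hun Real.pi_pos)
    have hsum : ∑ m : Fin n, Real.cos ((2 * ((m : ℕ) : ℝ) + 1) * θ) = 0 := by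
      have h0 := sum_cos_odd_mul n θ
      have h1 : 2 * (n : ℝ) * θ = ((2 * (u : ℕ) : ℕ) : ℝ) * Real.pi := by
        rw [hθ]; push_cast; field_simp
      rw [h1, Real.sin_nat_mul_pi] at h0
      simpa [hsin.ne'] using h0
    have hterm : ∀ m : Fin n, (dctFactor n u *
        Real.cos ((2 * ((m : ℕ) : ℝ) + 1) * ((u : ℕ) : ℝ) * Real.pi / (2 * (n : ℝ)))) ^ 2 =
        1 / n + 1 / n * Real.cos ((2 * ((m : ℕ) : ℝ) + 1) * θ) := fun m ↦ by
      have h2 : (2 * ((m : ℕ) : ℝ) + 1) * θ =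
          2 * ((2 * ((m : ℕ) : ℝ) + 1) * ((u : ℕ) : ℝ) * Real.pi / (2 * (n : ℝ))) := by
        rw [hθ]; field_simp
      rw [mul_pow, Real.cos_sq, ← h2, dctFactor, if_neg hu, Real.sq_sqrt (by positivity)]
      ring
    simp only [hterm, Finset.sum_add_distrib, ← Finset.mul_sum, hsum]
    simp [hn.ne']

/-- The coefficients of the two-dimensional cosine transform. -/
noncomputable def dctCoeff (k p : Fin h × Fin w) : ℝ :=
  (dctFactor h k.1 *
    Real.cos ((2 * ((p.1 : ℕ) : ℝ) + 1) * ((k.1 : ℕ) : ℝ) * Real.pi / (2 * (h : ℝ)))) *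
  (dctFactor w k.2 *
    Real.cos ((2 * ((p.2 : ℕ) : ℝ) + 1) * ((k.2 : ℕ) : ℝ) * Real.pi / (2 * (w : ℝ))))

theorem imageDCT_eq_imagePairing (x : Image h w) (k : Fin h × Fin w) :
    imageDCT x k = imagePairing (dctCoeff k) x := by
  simp only [imageDCT, imagePairing, dctCoeff, Fintype.sum_prod_type, Finset.mul_sum]
  exact Finset.sum_congr rfl fun m _ ↦ Finset.sum_congr rfl fun n _ ↦ by ring

theorem sum_dctCoeff_sq (k : Fin h × Fin w) : ∑ p, dctCoeff k p ^ 2 = 1 := by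
  simp only [dctCoeff, mul_pow (_ * _) (_ * _), Fintype.sum_prod_type, ← Finset.mul_sum,
    sum_dct_coeff_sq, mul_one]

end Coefficients

/-! ### The order in which frequencies are drowned -/

theorem highFrequenciesDrownFirst_of_noisePower_eq {Ω : Type*} [MeasurableSpace Ω]
    {P : Measure Ω} {h w : ℕ} {ι V : Type*} [Norm V] {F : Image h w → ι → V} {freq : ι → Freq}
    {T : ℝ≥0} {g : ℝ → ℝ} (hg : MemLp g 2 (volume.restrict (Set.Ioc (0 : ℝ) T)))
    {x₀ : Image h w} {x : ℝ≥0 → Ω → Image h w}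
    (hF : ∀ t ≤ T, ∀ k, noisePower F P x₀ x t k = ∫ s in (0 : ℝ)..(t : ℝ), |g s| ^ 2) :
    HighFrequenciesDrownFirst F freq T P x₀ x := by
  intro K α S hK hα hS j hj k hk hjk
  obtain ⟨hj0, hjp⟩ := hS j hj
  obtain ⟨-, hkp⟩ := hS k hk
  have hlt : ‖F x₀ k‖ ^ 2 < ‖F x₀ j‖ ^ 2 := by
    rw [hjp, hkp]
    exact mul_lt_mul_of_pos_left
      (Real.rpow_lt_rpow_of_neg (norm_pos_iff.2 hj0) hjk (neg_neg_of_pos hα)) hK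
  have hkpos : 0 < ‖F x₀ k‖ ^ 2 := by
    rw [hkp]
    exact mul_pos hK (Real.rpow_pos_of_pos ((norm_nonneg _).trans_lt hjk) _)
  have hint : IntervalIntegrable (fun s ↦ |g s| ^ 2) volume 0 T := by
    rw [intervalIntegrable_iff_integrableOn_Ioc_of_le T.coe_nonneg]
    simpa only [sq_abs, IntegrableOn] using hg.integrable_sq
  constructor
  · intro t ht hpos
    rw [snr, snr, hF t ht j, ← hF t ht k]
    exact div_lt_div_of_pos_right hlt hpos
  · intro γ hγ t ht hd
    rw [Drowned, hF t ht j] at hd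
    have hcont : ContinuousOn (fun r : ℝ ↦ γ * ∫ s in (0 : ℝ)..r, |g s| ^ 2)
        (Set.Icc 0 (t : ℝ)) := by
      have := intervalIntegral.continuousOn_primitive_interval' hint Set.left_mem_uIcc
      rw [Set.uIcc_of_le T.coe_nonneg] at this
      exact (this.mono (Set.Icc_subset_Icc_right (mod_cast ht))).const_mul γ
    -- At time `s` the scaled noise power equals the clean power at `k`, a level between 0 and the
    -- value at `t`.
    obtain ⟨s, hs, hsk⟩ := intermediate_value_Icc t.coe_nonneg hcont
      (show ‖F x₀ k‖ ^ 2 ∈ _ from ⟨by simpa using hkpos.le, (hlt.trans_le hd).le⟩)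
    simp only at hsk
    refine ⟨⟨s, hs.1⟩, lt_of_le_of_ne hs.2 ?_, ?_⟩
    -- If `s = t`, the clean power at `k` would be at least that at `j`.
    · intro he
      have : s = t := congrArg NNReal.toReal he
      rw [this] at hsk
      linarith
    · intro r hsr hrT
      rw [Drowned, hF r hrT k, ← hsk]
      refine mul_le_mul_of_nonneg_left ?_ hγ.le
      refine intervalIntegral.integral_mono_interval le_rfl hs.1 hsr
        (ae_of_all _ fun s ↦ by positivity) (hint.mono_set ?_)
      rw [Set.uIcc_of_le r.coe_nonneg, Set.uIcc_of_le T.coe_nonneg]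
      exact Set.Icc_subset_Icc_right (mod_cast hrT)

end SpectralDiffusion

theorem theorem1 {Ω : Type*} [MeasurableSpace Ω] (P : Measure Ω) [IsProbabilityMeasure P]
    (h w : ℕ) (hh : 0 < h) (hw : 0 < w)
    (T : ℝ≥0) (g : ℝ → ℝ) (hg : MemLp g 2 (volume.restrict (Set.Ioc (0 : ℝ) (T : ℝ))))
    (W : Fin h × Fin w → ℝ≥0 → Ω → ℝ) (hW : IsStandardWiener W P)
    (x₀ : Image h w) (x : ℝ≥0 → Ω → Image h w)
    (hx : IsForwardDiffusion (fun _ _ ↦ 0) g T W P x₀ x) :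
    (∀ t ≤ T, ∀ ω : Freq,
      Integrable (fun ξ ↦ ‖imageFourier (x t ξ) ω‖ ^ 2) P ∧
      ∫ ξ, ‖imageFourier (x t ξ) ω‖ ^ 2 ∂P =
        ‖imageFourier x₀ ω‖ ^ 2 + ∫ s in (0 : ℝ)..(t : ℝ), |g s| ^ 2 ∧
      Integrable (fun ξ ↦ ‖imageFourier (x t ξ - x₀) ω‖ ^ 2) P ∧
      noisePower imageFourier P x₀ x t ω = ∫ s in (0 : ℝ)..(t : ℝ), |g s| ^ 2) ∧
    HighFrequenciesDrownFirst imageFourier id T P x₀ x ∧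
    (∀ t ≤ T, ∀ k : Fin h × Fin w,
      Integrable (fun ξ ↦ ‖imageDCT (x t ξ) k‖ ^ 2) P ∧
      ∫ ξ, ‖imageDCT (x t ξ) k‖ ^ 2 ∂P =
        ‖imageDCT x₀ k‖ ^ 2 + ∫ s in (0 : ℝ)..(t : ℝ), |g s| ^ 2 ∧
      Integrable (fun ξ ↦ ‖imageDCT (x t ξ - x₀) k‖ ^ 2) P ∧
      noisePower imageDCT P x₀ x t k = ∫ s in (0 : ℝ)..(t : ℝ), |g s| ^ 2) ∧
    HighFrequenciesDrownFirst imageDCT dctFreq T P x₀ x := by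
  have hfourier := fun t (ht : t ≤ T) (ω : Freq) ↦
    transform_power hg hW hx imageFourier ω _ (fun y ↦ norm_imageFourier_sq y ω)
      (sum_fourier_coeff_sq hh hw ω) ht
  have hdct := fun t (ht : t ≤ T) (k : Fin h × Fin w) ↦
    -- The DCT is real, so a single functional suffices.
    transform_power hg hW hx imageDCT k (fun _ : Unit ↦ dctCoeff k)
      (fun y ↦ by simp [imageDCT_eq_imagePairing]) (by simp [sum_dctCoeff_sq]) ht
  exact ⟨hfourier,
    highFrequenciesDrownFirst_of_noisePower_eq hg fun t ht ω ↦ (hfourier t ht ω).2.2.2,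
    hdct, highFrequenciesDrownFirst_of_noisePower_eq hg fun t ht k ↦ (hdct t ht k).2.2.2⟩
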